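/- Let $W=(W_t)_{t\ge 0}$ be a standard Brownian motion on a probability space and let $\mu\in\mathbb{R}$. For $T>0$ put $$a_T=\frac1T\int_0^T e^{2(W_s+\mu s)}\,ds,\qquad z_T=e^{W_T+\mu T}.$$ Then, as $T\downarrow 0$, $$\frac{(a_T,z_T)-(1,1)}{\sqrt T}\ \xrightarrow{\ d\ }\ N(0,\hat\Sigma),\qquad \hat\Sigma=\begin{pmatrix}4/3&1\\1&1\end{pmatrix},$$ i.e. the normalized vector converges in distribution to the centered bivariate normal law with covariance matrix $\hat\Sigma$. -/

import Mathlib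

open MeasureTheory ProbabilityTheory Filter Topology
open scoped NNReal

/-- The time average `a_T = (1/T) ∫₀ᵀ exp (2 (W_s + μ s)) ds` of the geometric Brownian motion
driven by the path `w` (a path is indexed by `ℝ≥0`; on the range of integration
`s.toNNReal` is just `s`). -/
noncomputable def gbmTimeAverage (μ : ℝ) (w : ℝ≥0 → ℝ) (T : ℝ≥0) : ℝ :=
  (1 / (T : ℝ)) * ∫ s in (0 : ℝ)..(T : ℝ), Real.exp (2 * (w s.toNNReal + μ * s))

/-- The terminal value `z_T = exp (W_T + μ T)` for the path `w`. -/
noncomputable def gbmTerminal (μ : ℝ) (w : ℝ≥0 → ℝ) (T : ℝ≥0) : ℝ :=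
  Real.exp (w T + μ * (T : ℝ))

/-- The normalized fluctuation `((a_T, z_T) - (1, 1)) / √T` as a vector of the Euclidean plane. -/
noncomputable def gbmFluctuation (μ : ℝ) (w : ℝ≥0 → ℝ) (T : ℝ≥0) : EuclideanSpace ℝ (Fin 2) :=
  (1 / Real.sqrt (T : ℝ)) • (!₂[gbmTimeAverage μ w T, gbmTerminal μ w T] - !₂[(1 : ℝ), 1])

/-! By Brownian scaling, `√T W(t/T)` is again a Brownian motion for each `T > 0`, so it may replace
`W` without changing the law of the fluctuation (`identDistrib_gbmFluctuation`). After rescaling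
time to `[0, 1]`, `T` enters only through `r = √T`: the fluctuation becomes the difference quotient
at `r = 0` of smooth functions of `r` equal to 1 there. It thus converges path by path to `(2 ∫₀¹ W,
W₁)` (`tendsto_gbmFluctuation_rescale`), and the drift, of order `r²`, disappears. This limit is
Gaussian: Riemann sums reduce its characteristic function to finite sums with covariance `min s t`
(`hasLaw_integral_pair`). -/

/-- Right-endpoint Riemann sums of a continuous function converge to its integral. -/
lemma tendsto_riemannSum {f : ℝ → ℝ} (hf : Continuous f) :
    Tendsto (fun n : ℕ ↦ (1 / (n : ℝ)) * ∑ k ∈ Finset.range n, f ((k + 1) / n)) atTop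
      (𝓝 (∫ s in (0 : ℝ)..1, f s)) := by
  have huc : UniformContinuousOn f (Set.Icc 0 1) :=
    isCompact_Icc.uniformContinuousOn_of_continuous hf.continuousOn
  rw [Metric.tendsto_atTop]
  intro ε hε
  obtain ⟨δ, hδ, h⟩ := Metric.uniformContinuousOn_iff.1 huc (ε / 2) (by positivity)
  obtain ⟨N, hN⟩ := exists_nat_gt (1 / δ)
  refine ⟨N, fun n hn ↦ ?_⟩
  have hn0 : (0 : ℝ) < n :=
    lt_of_lt_of_le ((by positivity : 0 < 1 / δ).trans hN) (by exact_mod_cast hn)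
  have hnδ : 1 / (n : ℝ) < δ := by
    rw [one_div_lt hn0 hδ]
    exact hN.trans_le (by exact_mod_cast hn)
  have hsplit : ∫ s in (0 : ℝ)..1, f s
      = ∑ k ∈ Finset.range n, ∫ s in ((k : ℝ) / n)..((k + 1 : ℝ) / n), f s := by
    have := intervalIntegral.sum_integral_adjacent_intervals (f := f) (μ := volume)
      (a := fun k : ℕ ↦ (k : ℝ) / n) (n := n) (fun k _ ↦ hf.intervalIntegrable _ _)
    simp only [Nat.cast_add, Nat.cast_one, Nat.cast_zero, zero_div, div_self hn0.ne'] at this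
    exact this.symm
  have hconst (k : ℕ) : (1 / (n : ℝ)) * f ((k + 1) / n)
      = ∫ _ in ((k : ℝ) / n)..((k + 1 : ℝ) / n), f ((k + 1) / n) := by
    rw [intervalIntegral.integral_const, smul_eq_mul]
    congr 1
    ring
  rw [dist_eq_norm, hsplit, Finset.mul_sum, ← Finset.sum_sub_distrib]
  calc _ ≤ ∑ k ∈ Finset.range n, ε / 2 * (1 / n) := by
        refine norm_sum_le_of_le _ fun k hk ↦ ?_
        have hk1 : (k : ℝ) + 1 ≤ n := by exact_mod_cast Finset.mem_range.1 hk
        rw [hconst, ← intervalIntegral.integral_sub (by simp) (hf.intervalIntegrable _ _)]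
        have hle : (k : ℝ) / n ≤ (k + 1) / n := by gcongr; linarith
        refine (intervalIntegral.norm_integral_le_of_norm_le_const (C := ε / 2) fun s hs ↦ ?_).trans
          (le_of_eq ?_)
        · rw [Set.uIoc_of_le hle] at hs
          rw [← dist_eq_norm]
          have h1 : (k + 1 : ℝ) / n ≤ 1 := (div_le_one hn0).2 hk1
          have h0 : 0 ≤ (k : ℝ) / n := by positivity
          have hgap : (k + 1 : ℝ) / n - k / n = 1 / n := by ring
          refine (h _ ⟨by positivity, h1⟩ s ⟨h0.trans hs.1.le, hs.2.trans h1⟩ ?_).le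
          rw [Real.dist_eq, abs_of_nonneg (sub_nonneg.2 hs.2)]
          linarith [hs.1]
        · rw [show (k + 1 : ℝ) / n - k / n = 1 / n by ring, abs_of_pos (by positivity)]
    _ = ε / 2 := by simp; field_simp
    _ < ε := by linarith

lemma toNNReal_add_one_div (k n : ℕ) : ((k + 1 : ℝ) / n).toNNReal = ((k + 1 : ℝ≥0) / n) := by
  rw [← Real.toNNReal_coe (r := (k + 1 : ℝ≥0) / n)]
  push_cast
  rfl

/-! ### Equality in law of path functionals -/

/-- If two processes have the same law along countably many times and `f` is a limit, on
continuous paths, of measurable functionals of the values at these times, then `f` has the same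
law under both processes. -/
lemma identDistrib_comp_of_tendsto {Ω ι κ E : Type*} {mΩ : MeasurableSpace Ω} {P : Measure Ω}
    [TopologicalSpace ι] [IsProbabilityMeasure P]
    [TopologicalSpace E] [TopologicalSpace.PseudoMetrizableSpace E] [HasOuterApproxClosed E]
    [MeasurableSpace E] [BorelSpace E] {X Y : ι → Ω → ℝ} (t : κ → ι)
    (hXY : IdentDistrib (fun ω k ↦ X (t k) ω) (fun ω k ↦ Y (t k) ω) P P)
    (hX : ∀ᵐ ω ∂P, Continuous fun t ↦ X t ω) (hY : ∀ᵐ ω ∂P, Continuous fun t ↦ Y t ω)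
    {f : (ι → ℝ) → E} {F : ℕ → (κ → ℝ) → E} (hF : ∀ n, Measurable (F n))
    (hf : ∀ w : ι → ℝ, Continuous w → Tendsto (fun n ↦ F n fun k ↦ w (t k)) atTop (𝓝 (f w))) :
    IdentDistrib (fun ω ↦ f fun t ↦ X t ω) (fun ω ↦ f fun t ↦ Y t ω) P P := by
  have hXm (n : ℕ) : AEMeasurable (fun ω ↦ F n fun k ↦ X (t k) ω) P :=
    (hF n).comp_aemeasurable hXY.aemeasurable_fst
  have hYm (n : ℕ) : AEMeasurable (fun ω ↦ F n fun k ↦ Y (t k) ω) P :=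
    (hF n).comp_aemeasurable hXY.aemeasurable_snd
  have hXt : ∀ᵐ ω ∂P, Tendsto (fun n ↦ F n fun k ↦ X (t k) ω) atTop (𝓝 (f fun t ↦ X t ω)) := by
    filter_upwards [hX] with ω hω using hf _ hω
  have hYt : ∀ᵐ ω ∂P, Tendsto (fun n ↦ F n fun k ↦ Y (t k) ω) atTop (𝓝 (f fun t ↦ Y t ω)) := by
    filter_upwards [hY] with ω hω using hf _ hω
  have hXl := aemeasurable_of_tendsto_metrizable_ae atTop hXm hXt
  have hYl := aemeasurable_of_tendsto_metrizable_ae atTop hYm hYt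
  refine ⟨hXl, hYl, ?_⟩
  have h1 := tendstoInDistribution_of_ae_tendsto hXm hXl hXt
  have h2 := tendstoInDistribution_of_ae_tendsto hYm hYl hYt
  have heq (n : ℕ) : P.map (fun ω ↦ F n fun k ↦ X (t k) ω)
      = P.map (fun ω ↦ F n fun k ↦ Y (t k) ω) :=
    (hXY.comp (hF n)).map_eq
  have h3 := h1.tendsto
  simp_rw [heq] at h3
  -- Weak limits are unique: `HasOuterApproxClosed` makes the space of probability measures
  -- Hausdorff.
  have := tendsto_nhds_unique h3 h2.tendsto
  simpa using congrArg Subtype.val this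

/-- Finite-dimensional laws determine the law of the family. Since `t` need not be injective, they
are compared on `I.image t` and pulled back to `I`. -/
lemma ProbabilityTheory.IsPreBrownianReal.identDistrib {Ω κ : Type*} {mΩ : MeasurableSpace Ω}
    [Countable κ] {P : Measure Ω} {X Y : ℝ≥0 → Ω → ℝ} (hX : IsPreBrownianReal X P)
    (hY : IsPreBrownianReal Y P) (t : κ → ℝ≥0) :
    IdentDistrib (fun ω k ↦ X (t k) ω) (fun ω k ↦ Y (t k) ω) P P := by
  classical
  have : IsProbabilityMeasure P := hX.isGaussianProcess.isProbabilityMeasure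
  rw [identDistrib_iff_forall_finset_identDistrib (X := fun k ↦ X (t k)) (Y := fun k ↦ Y (t k))
    (aemeasurable_pi_lambda _ fun _ ↦ hX.aemeasurable _)
    (aemeasurable_pi_lambda _ fun _ ↦ hY.aemeasurable _)]
  intro I
  have h := (hX.hasLaw (I.image t)).identDistrib (hY.hasLaw (I.image t))
  exact h.comp (u := fun w (k : I) ↦ w ⟨t k, Finset.mem_image_of_mem t k.2⟩) (by fun_prop)

/-! ### Finite linear combinations of Brownian values -/

/-- The characteristic function of a finite linear combination of values of a Brownian motion. -/
lemma ProbabilityTheory.IsPreBrownianReal.integral_cexp_sum {Ω : Type*} {mΩ : MeasurableSpace Ω}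
    {P : Measure Ω} {W : ℝ≥0 → Ω → ℝ} (hW : IsPreBrownianReal W P) {ι : Type*} (I : Finset ι)
    (c : ι → ℝ) (t : ι → ℝ≥0) :
    ∫ ω, Complex.exp (((∑ k ∈ I, c k * W (t k) ω : ℝ) : ℂ) * Complex.I) ∂P
      = Complex.exp (-(((∑ i ∈ I, ∑ j ∈ I, c i * c j * min (t i) (t j) : ℝ)) : ℂ) / 2) := by
  have : IsProbabilityMeasure P := hW.isGaussianProcess.isProbabilityMeasure
  have hG : HasGaussianLaw (fun ω ↦ ∑ k ∈ I, c k * W (t k) ω) P := by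
    simpa using ((hW.isGaussianProcess.comp_right t).smul c).hasGaussianLaw_fun_sum (I := I)
  have hL (k : ι) : MemLp (fun ω ↦ c k * W (t k) ω) 2 P :=
    (hW.isGaussianProcess.hasGaussianLaw_eval (t k)).memLp_two.const_mul _
  have hmean : ∫ ω, ∑ k ∈ I, c k * W (t k) ω ∂P = 0 := by
    rw [integral_finsetSum _ fun k _ ↦ (hL k).integrable (by norm_num)]
    simp [integral_const_mul, hW.integral_eval]
  have hvar : Var[fun ω ↦ ∑ k ∈ I, c k * W (t k) ω; P]
      = ∑ i ∈ I, ∑ j ∈ I, c i * c j * min (t i) (t j) := by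
    rw [← covariance_self hG.aemeasurable,
      covariance_fun_sum_fun_sum' (fun i _ ↦ hL i) (fun i _ ↦ hL i)]
    refine Finset.sum_congr rfl fun i _ ↦ Finset.sum_congr rfl fun j _ ↦ ?_
    rw [covariance_const_mul_left, covariance_const_mul_right, hW.covariance_fun_eval]
    push_cast
    ring
  have h := hG.charFun_map_eq 1
  rw [charFun_apply_real, integral_map hG.aemeasurable (by fun_prop)] at h
  simpa [hmean, hvar, neg_div] using h

lemma sum_range_add_one (n : ℕ) : ∑ i ∈ Finset.range n, (i + 1 : ℝ) = n * (n + 1) / 2 := by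
  induction n with
  | zero => simp
  | succ n ih => rw [Finset.sum_range_succ, ih]; push_cast; ring

/-- Divided by `n ^ 3`, this is the variance of the Riemann sum of `W` on `[0, 1]`; its limit 1/3 is
the variance of `∫₀¹ W`. -/
lemma sum_range_sum_range_min (n : ℕ) :
    ∑ i ∈ Finset.range n, ∑ j ∈ Finset.range n, (min (i + 1 : ℝ) (j + 1))
      = n * (n + 1) * (2 * n + 1) / 6 := by
  induction n with
  | zero => simp
  | succ n ih =>
    have h1 : ∀ i ∈ Finset.range n, min (i + 1 : ℝ) (n + 1) = i + 1 := fun i hi ↦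
      min_eq_left (by gcongr; exact (Finset.mem_range.1 hi).le)
    have h2 : ∀ i ∈ Finset.range n, min (n + 1 : ℝ) (i + 1) = i + 1 := fun i hi ↦ by
      rw [min_comm, h1 i hi]
    simp_rw [Finset.sum_range_succ _ n, Finset.sum_add_distrib]
    rw [ih, Finset.sum_congr rfl h1, Finset.sum_congr rfl h2, sum_range_add_one]
    push_cast
    rw [min_self]
    ring

/-! ### Law and pathwise limit of the fluctuation -/

lemma gbmTimeAverage_eq_integral_unit (μ : ℝ) (w : ℝ≥0 → ℝ) {T : ℝ≥0} (hT : T ≠ 0) :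
    gbmTimeAverage μ w T
      = ∫ s in (0 : ℝ)..1, Real.exp (2 * (w (T * s.toNNReal) + μ * (T * s))) := by
  have h := intervalIntegral.integral_comp_mul_left (a := 0) (b := 1)
    (fun s : ℝ ↦ Real.exp (2 * (w s.toNNReal + μ * s))) (NNReal.coe_ne_zero.2 hT)
  simp only [Real.toNNReal_mul T.coe_nonneg, Real.toNNReal_coe, mul_zero, mul_one] at h
  rw [h, gbmTimeAverage, smul_eq_mul, one_div]

lemma tendsto_vec2 {α : Type*} {l : Filter α} {f g : α → ℝ} {a b : ℝ} (hf : Tendsto f l (𝓝 a))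
    (hg : Tendsto g l (𝓝 b)) : Tendsto (fun x ↦ !₂[f x, g x]) l (𝓝 !₂[a, b]) := by
  have hc : Continuous fun p : ℝ × ℝ ↦ !₂[p.1, p.2] := by fun_prop
  exact (hc.tendsto (a, b)).comp (hf.prodMk_nhds hg)

/-- The law of the fluctuation does not depend on the Brownian motion. -/
lemma identDistrib_gbmFluctuation {Ω : Type*} {mΩ : MeasurableSpace Ω} {P : Measure Ω}
    {X Y : ℝ≥0 → Ω → ℝ} (hX : IsBrownianReal X P) (hY : IsBrownianReal Y P) (μ : ℝ) (T : ℝ≥0) :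
    IdentDistrib (fun ω ↦ gbmFluctuation μ (fun t ↦ X t ω) T)
      (fun ω ↦ gbmFluctuation μ (fun t ↦ Y t ω) T) P P := by
  have : IsProbabilityMeasure P := hX.isGaussianProcess.isProbabilityMeasure
  -- All grid points of `[0, T]` at once; the index `(1, 0)` is the time `T` itself.
  let t : ℕ × ℕ → ℝ≥0 := fun p ↦ T * ((p.2 + 1) / p.1)
  let F : ℕ → (ℕ × ℕ → ℝ) → EuclideanSpace ℝ (Fin 2) := fun n v ↦
    (1 / √(T : ℝ)) • (!₂[(1 / (n : ℝ)) * ∑ k ∈ Finset.range n,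
      Real.exp (2 * (v (n, k) + μ * (T * ((k + 1) / n)))),
        Real.exp (v (1, 0) + μ * T)] - !₂[(1 : ℝ), 1])
  refine identDistrib_comp_of_tendsto (f := fun w ↦ gbmFluctuation μ w T) t
    (hX.toIsPreBrownianReal.identDistrib hY.toIsPreBrownianReal t)
    hX.cont hY.cont (F := F) (fun n ↦ ?_) (fun w hw ↦ ?_)
  · have : Measurable fun p : ℝ × ℝ ↦ !₂[p.1, p.2] := by fun_prop
    have h : Measurable fun v : ℕ × ℕ → ℝ ↦ (1 / (n : ℝ)) * ∑ k ∈ Finset.range n,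
        Real.exp (2 * (v (n, k) + μ * (T * ((k + 1) / n)))) := by fun_prop
    have h' : Measurable fun v : ℕ × ℕ → ℝ ↦ Real.exp (v (1, 0) + μ * T) := by fun_prop
    exact ((this.comp (h.prodMk h')).sub_const !₂[(1 : ℝ), 1]).const_smul (1 / √(T : ℝ))
  · rcases eq_or_ne T 0 with rfl | hT
    -- At `T = 0` the factor `1 / √T` is 0 by convention, so both sides vanish.
    · simp [gbmFluctuation, F]
    refine Tendsto.const_smul (Tendsto.sub_const (tendsto_vec2 ?_ ?_) _) _
    · rw [gbmTimeAverage_eq_integral_unit μ w hT]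
      refine (tendsto_riemannSum (f := fun s : ℝ ↦
        Real.exp (2 * (w (T * s.toNNReal) + μ * (T * s)))) (by fun_prop)).congr fun n ↦ ?_
      simp only [toNNReal_add_one_div, t]
    · simp [gbmTerminal, t]

/-- First-order expansion at `r = 0` of `∫₀¹ exp (2 (r g(s) + μ r² s)) ds`. -/
lemma hasDerivAt_integral_exp {g : ℝ → ℝ} (hg : Continuous g) (μ : ℝ) :
    HasDerivAt (fun r : ℝ ↦ ∫ s in (0 : ℝ)..1, Real.exp (2 * (r * g s + μ * (r ^ 2 * s))))
      (2 * ∫ s in (0 : ℝ)..1, g s) 0 := by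
  let F' : ℝ → ℝ → ℝ := fun r s ↦
    Real.exp (2 * (r * g s + μ * (r ^ 2 * s))) * (2 * (g s + μ * (2 * r * s)))
  have hF' : Continuous fun p : ℝ × ℝ ↦ F' p.1 p.2 := by fun_prop
  obtain ⟨C, hC⟩ := ((isCompact_Icc (a := (-1 : ℝ)) (b := 1)).prod
    (isCompact_Icc (a := (0 : ℝ)) (b := 1))).exists_bound_of_continuousOn hF'.continuousOn
  have h := (intervalIntegral.hasDerivAt_integral_of_dominated_loc_of_deriv_le
    (μ := volume) (a := 0) (b := 1) (x₀ := 0) (s := Set.Icc (-1) 1) (bound := fun _ ↦ C)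
    (F := fun r s ↦ Real.exp (2 * (r * g s + μ * (r ^ 2 * s)))) (F' := F')
    (Icc_mem_nhds (by norm_num) (by norm_num))
    (.of_forall fun r ↦ Continuous.aestronglyMeasurable (by fun_prop))
    (Continuous.intervalIntegrable (by fun_prop) _ _)
    (Continuous.aestronglyMeasurable (by fun_prop))
    (.of_forall fun s hs r hr ↦ hC (r, s) ⟨hr, ?_⟩) (by simp)
    (.of_forall fun s _ r _ ↦ ?_)).2
  · simpa [F', intervalIntegral.integral_const_mul] using h
  · rw [Set.uIoc_of_le zero_le_one] at hs
    exact ⟨hs.1.le, hs.2⟩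
  · refine HasDerivAt.exp (HasDerivAt.const_mul 2 (HasDerivAt.add ?_ ?_))
    · simpa using (hasDerivAt_id r).mul_const (g s)
    · simpa using (((hasDerivAt_id r).pow 2).mul_const s).const_mul μ

/-- Pathwise convergence of the fluctuation of the rescaled path `t ↦ √T w(t / T)`. -/
lemma tendsto_gbmFluctuation_rescale (μ : ℝ) {w : ℝ≥0 → ℝ} (hw : Continuous w) :
    Tendsto (fun T : ℝ≥0 ↦ gbmFluctuation μ (fun t ↦ (√((T⁻¹ : ℝ≥0) : ℝ))⁻¹ * w (T⁻¹ * t)) T)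
      (𝓝[>] 0) (𝓝 !₂[2 * ∫ s in (0 : ℝ)..1, w s.toNNReal, w 1]) := by
  have hsqrt : Tendsto (fun T : ℝ≥0 ↦ √(T : ℝ)) (𝓝[>] 0) (𝓝[≠] 0) := by
    refine tendsto_nhdsWithin_iff.2 ⟨?_, ?_⟩
    · have : Continuous fun T : ℝ≥0 ↦ √(T : ℝ) := by fun_prop
      simpa using (this.tendsto 0).mono_left nhdsWithin_le_nhds
    · filter_upwards [self_mem_nhdsWithin] with T hT
      have : (0 : ℝ) < T := hT
      exact (Real.sqrt_pos.2 this).ne'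
  have hd1 := hasDerivAt_integral_exp (g := fun s ↦ w s.toNNReal) (by fun_prop) μ
  have hd2 : HasDerivAt (fun r : ℝ ↦ Real.exp (r * w 1 + μ * r ^ 2)) (w 1) 0 := by
    have h : HasDerivAt (fun r : ℝ ↦ r * w 1 + μ * r ^ 2) (w 1) 0 := by
      simpa using ((hasDerivAt_id (0 : ℝ)).mul_const (w 1)).fun_add
        (((hasDerivAt_id (0 : ℝ)).pow 2).const_mul μ)
    simpa using h.exp
  -- With `r = √T`, the slopes at 0 are the two coordinates of the fluctuation.
  refine (tendsto_vec2 (hd1.tendsto_slope.comp hsqrt) (hd2.tendsto_slope.comp hsqrt)).congr' ?_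
  filter_upwards [self_mem_nhdsWithin] with T hT
  have hT0 : T ≠ 0 := ne_of_gt hT
  have hsq : √(T : ℝ) ^ 2 = T := Real.sq_sqrt T.coe_nonneg
  have hinv : (√((T⁻¹ : ℝ≥0) : ℝ))⁻¹ = √(T : ℝ) := by simp
  rw [gbmFluctuation, gbmTimeAverage_eq_integral_unit _ _ hT0, gbmTerminal, hinv]
  simp only [inv_mul_cancel_left₀ hT0, inv_mul_cancel₀ hT0, Function.comp_apply, slope_def_field,
    hsq]
  ext i
  fin_cases i <;> simp [div_eq_inv_mul]

/-! ### The Gaussian limit -/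

lemma tendsto_riemannSum_nnreal {w : ℝ≥0 → ℝ} (hw : Continuous w) :
    Tendsto (fun n : ℕ ↦ (1 / (n : ℝ)) * ∑ k ∈ Finset.range n, w ((k + 1) / n)) atTop
      (𝓝 (∫ s in (0 : ℝ)..1, w s.toNNReal)) := by
  refine (tendsto_riemannSum (f := fun s ↦ w s.toNNReal) (by fun_prop)).congr fun n ↦ ?_
  simp only [toNNReal_add_one_div]

/-- The quadratic form is `(x 0 + x 1) ^ 2 + x 0 ^ 2 / 3`. Positivity is needed for the
characteristic function of `multivariateGaussian`. -/
lemma posSemidef_limitCovariance : (!![(4 / 3 : ℝ), 1; 1, 1]).PosSemidef := by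
  refine Matrix.PosSemidef.of_dotProduct_mulVec_nonneg ?_ fun x ↦ ?_
  · ext i j
    fin_cases i <;> fin_cases j <;> simp
  · simp [Matrix.mulVec, dotProduct, Fin.sum_univ_two]
    nlinarith [sq_nonneg (x 0 + x 1), sq_nonneg (x 0)]

/-- Covariance form of a Riemann sum of a Brownian motion together with its value at time one. -/
lemma sum_covariance_riemann (a b : ℝ) {n : ℕ} (hn : n ≠ 0) :
    ∑ i ∈ Finset.range (n + 1), ∑ j ∈ Finset.range (n + 1),
      (if i = n then b else a / n) * (if j = n then b else a / n)
        * ((min (if i = n then 1 else (i + 1) / n : ℝ≥0) (if j = n then 1 else (j + 1) / n : ℝ≥0) :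
          ℝ≥0) : ℝ)
      = a ^ 2 * ((1 + 1 / n) * (2 + 1 / n) / 6) + a * b * (1 + 1 / n) + b ^ 2 := by
  have hn0 : (n : ℝ) ≠ 0 := Nat.cast_ne_zero.2 hn
  have hpos : (0 : ℝ) < n := by positivity
  have hne {i : ℕ} (hi : i ∈ Finset.range n) : i ≠ n := (Finset.mem_range.1 hi).ne
  have hle {i : ℕ} (hi : i ∈ Finset.range n) : (i + 1 : ℝ) / n ≤ 1 :=
    (div_le_one hpos).2 (by exact_mod_cast Finset.mem_range.1 hi)
  have hcross : ∑ i ∈ Finset.range n, a / n * b * ((i + 1 : ℝ) / n) = a * b * (1 + 1 / n) / 2 := by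
    rw [← Finset.mul_sum, ← Finset.sum_div, sum_range_add_one]
    field_simp
  have hmain : ∑ i ∈ Finset.range n, ∑ j ∈ Finset.range n,
      a / n * (a / n) * min ((i + 1 : ℝ) / n) ((j + 1) / n)
        = a ^ 2 * ((1 + 1 / n) * (2 + 1 / n) / 6) := by
    simp_rw [min_div_div_right hpos.le, ← Finset.mul_sum, ← Finset.sum_div]
    rw [sum_range_sum_range_min]
    field_simp
  rw [Finset.sum_range_succ]
  simp_rw [Finset.sum_range_succ _ n, Finset.sum_add_distrib, if_true]
  have h11 : ∀ i ∈ Finset.range n, ∀ j ∈ Finset.range n,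
      (if i = n then b else a / n) * (if j = n then b else a / n)
        * ((min (if i = n then 1 else (i + 1) / n : ℝ≥0) (if j = n then 1 else (j + 1) / n : ℝ≥0) :
          ℝ≥0) : ℝ) = a / n * (a / n) * min ((i + 1 : ℝ) / n) ((j + 1) / n) := fun i hi j hj ↦ by
    simp only [if_neg (hne hi), if_neg (hne hj)]
    push_cast
    rfl
  have h12 : ∀ i ∈ Finset.range n,
      (if i = n then b else a / n) * b
        * ((min (if i = n then 1 else (i + 1) / n : ℝ≥0) 1 :
          ℝ≥0) : ℝ) = a / n * b * ((i + 1 : ℝ) / n) := fun i hi ↦ by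
    simp only [if_neg (hne hi)]
    push_cast
    rw [min_eq_left (hle hi)]
  have h21 : ∀ i ∈ Finset.range n,
      b * (if i = n then b else a / n)
        * ((min 1 (if i = n then 1 else (i + 1) / n : ℝ≥0) :
          ℝ≥0) : ℝ) = a / n * b * ((i + 1 : ℝ) / n) := fun i hi ↦ by
    rw [min_comm, mul_comm b, h12 i hi]
  rw [Finset.sum_congr rfl fun i hi ↦ Finset.sum_congr rfl (h11 i hi), Finset.sum_congr rfl h12,
    Finset.sum_congr rfl h21, hmain, hcross]
  simp only [min_self, NNReal.coe_one]
  ring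

/-- The characteristic function of a linear combination of `∫₀¹ W` and `W₁`. -/
lemma ProbabilityTheory.IsBrownianReal.integral_cexp_integral {Ω : Type*} {mΩ : MeasurableSpace Ω}
    {P : Measure Ω} {W : ℝ≥0 → Ω → ℝ} (hW : IsBrownianReal W P) (a b : ℝ) :
    ∫ ω, Complex.exp
        (((a * ∫ s in (0 : ℝ)..1, W s.toNNReal ω) + b * W 1 ω : ℝ) * Complex.I) ∂P
      = Complex.exp (-((a ^ 2 / 3 + a * b + b ^ 2 : ℝ) : ℂ) / 2) := by
  have : IsProbabilityMeasure P := hW.isGaussianProcess.isProbabilityMeasure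
  -- The extra index `n` carries the term `b * W 1`, so that `S n` is a single linear combination of
  -- values of `W`.
  let c : ℕ → ℕ → ℝ := fun n k ↦ if k = n then b else a / n
  let t : ℕ → ℕ → ℝ≥0 := fun n k ↦ if k = n then 1 else (k + 1) / n
  let S : ℕ → Ω → ℝ := fun n ω ↦ ∑ k ∈ Finset.range (n + 1), c n k * W (t n k) ω
  have hS (n : ℕ) (ω : Ω) :
      S n ω = a * ((1 / (n : ℝ)) * ∑ k ∈ Finset.range n, W ((k + 1) / n) ω) + b * W 1 ω := by
    simp only [S, Finset.sum_range_succ, c, t, if_pos]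
    congr 1
    rw [← mul_assoc, mul_one_div, Finset.mul_sum]
    refine Finset.sum_congr rfl fun k hk ↦ ?_
    rw [if_neg (Finset.mem_range.1 hk).ne, if_neg (Finset.mem_range.1 hk).ne]
  have hSm (n : ℕ) : AEMeasurable (S n) P :=
    Finset.aemeasurable_fun_sum _ fun k _ ↦ (hW.aemeasurable _).const_mul _
  have h1 : Tendsto (fun n ↦ ∫ ω, Complex.exp ((S n ω : ℂ) * Complex.I) ∂P) atTop
      (𝓝 (∫ ω, Complex.exp
        (((a * ∫ s in (0 : ℝ)..1, W s.toNNReal ω) + b * W 1 ω : ℝ) * Complex.I) ∂P)) := by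
    refine tendsto_integral_of_dominated_convergence (fun _ ↦ 1)
      (fun n ↦ ?_) (integrable_const _) (fun n ↦ .of_forall fun ω ↦ ?_) ?_
    · have := hSm n
      exact AEMeasurable.aestronglyMeasurable (by fun_prop)
    · rw [Complex.norm_exp_ofReal_mul_I]
    · filter_upwards [hW.cont] with ω hω
      have hlim := ((tendsto_riemannSum_nnreal hω).const_mul a).add_const (b * W 1 ω)
      simp_rw [← hS] at hlim
      have hc : Continuous fun x : ℝ ↦ Complex.exp ((x : ℂ) * Complex.I) := by fun_prop
      exact (hc.tendsto _).comp hlim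
  have h2 : Tendsto (fun n ↦ ∫ ω, Complex.exp ((S n ω : ℂ) * Complex.I) ∂P) atTop
      (𝓝 (Complex.exp (-((a ^ 2 / 3 + a * b + b ^ 2 : ℝ) : ℂ) / 2))) := by
    have hq : Tendsto (fun n : ℕ ↦
        a ^ 2 * ((1 + 1 / (n : ℝ)) * (2 + 1 / n) / 6) + a * b * (1 + 1 / n) + b ^ 2) atTop
        (𝓝 (a ^ 2 / 3 + a * b + b ^ 2)) := by
      have h0 := tendsto_one_div_atTop_nhds_zero_nat (𝕜 := ℝ)
      have hc : Continuous fun x : ℝ ↦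
        a ^ 2 * ((1 + x) * (2 + x) / 6) + a * b * (1 + x) + b ^ 2 := by fun_prop
      have h := (hc.tendsto 0).comp h0
      rwa [show a ^ 2 * ((1 + 0) * (2 + 0) / 6) + a * b * (1 + 0) + b ^ 2
        = a ^ 2 / 3 + a * b + b ^ 2 by ring] at h
    have hc : Continuous fun x : ℝ ↦ Complex.exp (-(x : ℂ) / 2) := by fun_prop
    refine ((hc.tendsto _).comp hq).congr' ?_
    filter_upwards [eventually_ne_atTop 0] with n hn
    rw [hW.integral_cexp_sum, Function.comp_apply, ← sum_covariance_riemann a b hn]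
  exact tendsto_nhds_unique h1 h2

/-- The vector `(2 ∫₀¹ W, W₁)` is centered Gaussian with covariance `(4/3, 1; 1, 1)`. -/
lemma ProbabilityTheory.IsBrownianReal.hasLaw_integral_pair {Ω : Type*} {mΩ : MeasurableSpace Ω}
    {P : Measure Ω} {W : ℝ≥0 → Ω → ℝ} (hW : IsBrownianReal W P) :
    HasLaw (fun ω ↦ !₂[2 * ∫ s in (0 : ℝ)..1, W s.toNNReal ω, W 1 ω])
      (multivariateGaussian 0 !![(4 / 3 : ℝ), 1; 1, 1]) P := by
  have : IsProbabilityMeasure P := hW.isGaussianProcess.isProbabilityMeasure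
  have hI : AEMeasurable (fun ω ↦ ∫ s in (0 : ℝ)..1, W s.toNNReal ω) P := by
    refine aemeasurable_of_tendsto_metrizable_ae atTop
      (f := fun (n : ℕ) ω ↦ (1 / (n : ℝ)) * ∑ k ∈ Finset.range n, W ((k + 1) / n) ω)
      (fun n ↦ ?_) ?_
    · exact (Finset.aemeasurable_fun_sum _ fun k _ ↦ hW.aemeasurable _).const_mul _
    · filter_upwards [hW.cont] with ω hω using tendsto_riemannSum_nnreal hω
  have hm : AEMeasurable (fun ω ↦ !₂[2 * ∫ s in (0 : ℝ)..1, W s.toNNReal ω, W 1 ω]) P := by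
    have hc : Measurable fun p : ℝ × ℝ ↦ !₂[p.1, p.2] := by fun_prop
    exact hc.comp_aemeasurable ((hI.const_mul 2).prodMk (hW.aemeasurable 1))
  refine ⟨hm, ?_⟩
  have := Measure.isProbabilityMeasure_map hm
  refine Measure.ext_of_charFun (funext fun x ↦ ?_)
  rw [charFun_multivariateGaussian posSemidef_limitCovariance, charFun_apply,
    integral_map hm (by fun_prop)]
  -- The factor 2 in the first coordinate turns `a ^ 2 / 3` into `4 / 3 * x 0 ^ 2`.
  have h := hW.integral_cexp_integral (2 * x 0) (x 1)
  convert h using 1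
  · refine integral_congr_ae (.of_forall fun ω ↦ ?_)
    simp [PiLp.inner_apply, Fin.sum_univ_two]
    ring_nf
  · simp [Matrix.mulVec, dotProduct, Fin.sum_univ_two]
    ring_nf

theorem proposition1p1 {Ω : Type*} {mΩ : MeasurableSpace Ω} (P : Measure Ω)
    [IsProbabilityMeasure P] (W : ℝ≥0 → Ω → ℝ) (hW : IsBrownianReal W P) (μ : ℝ) :
    TendstoInDistribution
      (fun (T : ℝ≥0) (ω : Ω) => gbmFluctuation μ (fun t => W t ω) T)
      (𝓝[>] (0 : ℝ≥0))
      (id : EuclideanSpace ℝ (Fin 2) → EuclideanSpace ℝ (Fin 2))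
      (fun _ => P)
      (multivariateGaussian (0 : EuclideanSpace ℝ (Fin 2)) !![(4 / 3 : ℝ), 1; 1, 1]) := by
  -- Scaling degenerates at `T = 0`, a time invisible to `𝓝[>] 0`; the value `W` there keeps `V T`
  -- Brownian for every `T`.
  let V : ℝ≥0 → ℝ≥0 → Ω → ℝ := fun T ↦ if T = 0 then W else
    fun t ω ↦ (√((T⁻¹ : ℝ≥0) : ℝ))⁻¹ * W (T⁻¹ * t) ω
  have hV (T : ℝ≥0) : IsBrownianReal (V T) P := by
    simp only [V]
    split_ifs with hT
    · exact hW
    · exact hW.smul (inv_ne_zero hT)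
  have hid (T : ℝ≥0) := identDistrib_gbmFluctuation (hV T) hW μ T
  have hlaw := hW.hasLaw_integral_pair
  have hlim := tendstoInDistribution_of_ae_tendsto (l := 𝓝[>] (0 : ℝ≥0))
    (fun T ↦ (hid T).aemeasurable_fst) hlaw.aemeasurable (by
      filter_upwards [hW.cont] with ω hω
      refine (tendsto_gbmFluctuation_rescale μ hω).congr' ?_
      filter_upwards [self_mem_nhdsWithin] with T hT
      have hT0 : T ≠ 0 := ne_of_gt (Set.mem_Ioi.1 hT)
      simp only [V, if_neg hT0])
  refine ⟨fun T ↦ (hid T).aemeasurable_snd, by fun_prop, ?_⟩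
  have h := hlim.tendsto
  -- Convergence in distribution sees only the laws, so `V T` can be exchanged for `W`.
  simp_rw [(hid _).map_eq, hlaw.map_eq] at h
  simpa only [Measure.map_id] using h
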